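/- Let $n\ge 1$ and $m\ge 0$ be integers. Write points of $\mathbb R^n=\mathbb R^{n-1}\times\mathbb R$ as $x=(x',x_n)$, and let $\mathtt x'=(\mathtt x_1,\dots,\mathtt x_{n-1})$, $\mathtt x=(\mathtt x',\mathtt x_n)$, $e_n=(0,\dots,0,1)$ and $\pi_n(x',x_n)=(x',0)$. Let $g_1,\dots,g_m,g_{m+1}\in\mathbb R[\mathtt x']$ be polynomials such that $g_{m+1}(x')>1$ for every $x'\in\mathbb R^{n-1}$, and set $$A=\{x\in\mathbb R^n:\ g_1(x')>0,\dots,g_m(x')>0,\ x_n=0\}.$$ Then there exists a polynomial $Q\in\mathbb R[\mathtt x]$ such that: (i) $\displaystyle\{x\in\mathbb R^n: Q(x)\le 0\}\subset\{a+\lambda e_n:\ a\in A,\ \lambda\in\mathbb R\}\cap\Big\{x\in\mathbb R^n:\ |x_n|>\max\Big\{g_{m+1}(x'),\ \frac{g_{m+1}(x')}{\sqrt{g_1(x')\cdots g_m(x')}}\Big\}\Big\}$ (an empty product is $1$; on the first set on the right all $g_i(x')$ with $i\le m$ are positive). (ii) For each $(x',0)\in A$ there exist a positive root $r\ge g_{m+1}(x')$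 of the univariate polynomial $Q(x',\mathtt t)$ and a real number $t\ge r$ such that $Q(x',t)=-1$. (iii) The set $S=\{y+\lambda e_n:\ y\in\mathbb R^n,\ Q(y)\le 0,\ y_n>0,\ \lambda\ge 0\}$ satisfies $\pi_n(S)=A$. In addition, for each $(x',x_n)\in S$ there exist $r_n>0$ and $t_n\ge 0$ such that $x_n=r_n+t_n$ and $Q(x',r_n)=0$. -/

import Mathlib

open MvPolynomial

/-! Points of `ℝⁿ`, `n = d + 1`, are functions `x : Fin (d + 1) → ℝ`. In `x = (x', x_n)` the point
`x' ∈ ℝⁿ⁻¹` is `Fin.init x` and `x_n` is `x (Fin.last d)`; conversely `(x', t)` is `Fin.snoc x' t`. -/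

namespace Pecker

/-- The point `(x', t)` of `ℝⁿ = ℝⁿ⁻¹ × ℝ`. -/
def pt {d : ℕ} (x' : Fin d → ℝ) (t : ℝ) : Fin (d + 1) → ℝ :=
  Fin.snoc (α := fun _ => ℝ) x' t

/-- The last vector `eₙ = (0, …, 0, 1)` of the standard basis of `ℝⁿ`. -/
def en (d : ℕ) : Fin (d + 1) → ℝ := Pi.single (Fin.last d) 1

/-- The vertical projection `πₙ : ℝⁿ → ℝⁿ`, `(x', x_n) ↦ (x', 0)`. -/
def piN {d : ℕ} (x : Fin (d + 1) → ℝ) : Fin (d + 1) → ℝ := pt (Fin.init x) 0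

/-- The cylinder `{x + λ v : x ∈ X, λ ∈ ℝ}` of base `X` in the direction `v`. -/
def cyl {d : ℕ} (X : Set (Fin d → ℝ)) (v : Fin d → ℝ) : Set (Fin d → ℝ) :=
  {y | ∃ x ∈ X, ∃ c : ℝ, y = x + c • v}

/-- The positive cylinder `{x + λ v : x ∈ X, λ ≥ 0}` of base `X` in the direction `v`. -/
def posCyl {d : ℕ} (X : Set (Fin d → ℝ)) (v : Fin d → ℝ) : Set (Fin d → ℝ) :=
  {y | ∃ x ∈ X, ∃ c : ℝ, 0 ≤ c ∧ y = x + c • v}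

/-- A tuple `(g₁, …, g_m, g_{m+1})` of polynomials in `ℝ[x']` is admissible if `g_{m+1} > 1` on
`ℝⁿ⁻¹`. -/
def IsAdmissible {d m : ℕ} (g : Fin (m + 1) → MvPolynomial (Fin d) ℝ) : Prop :=
  ∀ x' : Fin d → ℝ, 1 < eval x' (g (Fin.last m))

/-- The set `{g₁ > 0, …, g_m > 0, x_n = 0} ⊆ ℝⁿ`. -/
def setA {d m : ℕ} (g : Fin (m + 1) → MvPolynomial (Fin d) ℝ) : Set (Fin (d + 1) → ℝ) :=
  {x | (∀ i : Fin m, 0 < eval (Fin.init x) (g i.castSucc)) ∧ x (Fin.last d) = 0}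

/-- The positive vertical cylinder over `{Q ≤ 0, x_n > 0}`. -/
def setS {d : ℕ} (Q : MvPolynomial (Fin (d + 1)) ℝ) : Set (Fin (d + 1) → ℝ) :=
  posCyl {x | eval x Q ≤ 0 ∧ 0 < x (Fin.last d)} (en d)

end Pecker

/-! Write `x = (x', t)`, `p = g₁ ⋯ g_m` and `G = g_{m+1}`. Start with `P₀ = 1 + L(x') - p(x') t²`,
where `L = 2 (1 + G²) ∏ (1 + gᵢ²)`, and eliminate the inequalities `gᵢ > 0` one after the other by
`Pᵢ = 1 + t² ((1 + gᵢ²) Pᵢ₋₁² - gᵢ)`. If `Pᵢ < 1` then `gᵢ > (1 + gᵢ²) Pᵢ₋₁²`, which forces `gᵢ > 0`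
and `Pᵢ₋₁ < 1`; hence `P_m < 1` gives all the inequalities and `L < p t²`, a bound strong enough for
the required lower bound on `|t|` and for `gᵢ t² ≥ 2`. Conversely, where all `gᵢ` are positive, a
root `t` of `Pᵢ₋₁` satisfies `Pᵢ = 1 - gᵢ t² ≤ -1`; since every `Pᵢ` is nonnegative at `t = 0` and
`P₀ ≤ -1` for large `t`, the intermediate value theorem provides such a root at each step. -/

namespace Pecker

section Inequalities

lemma prod_le_prod_one_add_sq {ι K : Type*} [CommRing K] [LinearOrder K] [IsStrictOrderedRing K]
    {s t : Finset ι} {f : ι → K} (hst : s ⊆ t) (hf : ∀ i ∈ s, 0 ≤ f i) :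
    ∏ i ∈ s, f i ≤ ∏ i ∈ t, (1 + f i ^ 2) := by
  calc ∏ i ∈ s, f i
      ≤ ∏ i ∈ s, (1 + f i ^ 2) :=
        Finset.prod_le_prod hf fun i _ => by linarith [sq_nonneg (f i - 1), sq_nonneg (f i)]
    _ ≤ ∏ i ∈ t, (1 + f i ^ 2) :=
        Finset.prod_le_prod_of_subset_of_one_le hst (fun i _ => by positivity)
          fun i _ _ => le_add_of_nonneg_right (sq_nonneg (f i))

variable {ι : Type*} [Fintype ι]

lemma two_le_mul_sq_of_lt_prod_mul_sq {K : Type*} [CommRing K] [LinearOrder K]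
    [IsStrictOrderedRing K] {f : ι → K} {G t : K} (hf : ∀ i, 0 < f i)
    (h : 2 * (1 + G ^ 2) * ∏ i, (1 + f i ^ 2) < (∏ i, f i) * t ^ 2) (i : ι) :
    2 ≤ f i * t ^ 2 := by
  classical
  set q := ∏ j ∈ Finset.univ.erase i, f j
  have hq : 0 < q := Finset.prod_pos fun j _ => hf j
  have hqW : q ≤ ∏ j, (1 + f j ^ 2) :=
    prod_le_prod_one_add_sq (Finset.erase_subset _ _) fun j _ => (hf j).le
  refine le_of_mul_le_mul_right ?_ hq
  calc 2 * q ≤ 2 * (1 + G ^ 2) * ∏ j, (1 + f j ^ 2) := by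
        gcongr
        linarith [sq_nonneg G]
    _ ≤ (∏ j, f j) * t ^ 2 := h.le
    _ = f i * t ^ 2 * q := by
        rw [← Finset.mul_prod_erase _ _ (Finset.mem_univ i)]
        ring

lemma max_abs_lt_abs_of_lt_prod_mul_sq {f : ι → ℝ} {G t : ℝ} (hf : ∀ i, 0 < f i)
    (h : 2 * (1 + G ^ 2) * ∏ i, (1 + f i ^ 2) < (∏ i, f i) * t ^ 2) :
    max |G| (|G| / √(∏ i, f i)) < |t| := by
  set p := ∏ i, f i
  set W := ∏ i, (1 + f i ^ 2)
  have hp : 0 < p := Finset.prod_pos fun i _ => hf i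
  have hpW : p ≤ W := prod_le_prod_one_add_sq subset_rfl fun i _ => (hf i).le
  have hW : 1 ≤ W := Finset.one_le_prod fun i _ => le_add_of_nonneg_right (sq_nonneg (f i))
  have hGW : G ^ 2 * W < p * t ^ 2 := by
    linarith [mul_nonneg (sq_nonneg G) (zero_le_one.trans hW)]
  refine max_lt (sq_lt_sq.1 ?_) (lt_of_pow_lt_pow_left₀ 2 (abs_nonneg t) ?_)
  · refine lt_of_mul_lt_mul_left ?_ hp.le
    calc p * G ^ 2 ≤ G ^ 2 * W := by rw [mul_comm]; gcongr
      _ < p * t ^ 2 := hGW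
  · rw [div_pow, Real.sq_sqrt hp.le, sq_abs, sq_abs, div_lt_iff₀' hp]
    exact (le_mul_of_one_le_right (sq_nonneg G) hW).trans_lt hGW

end Inequalities

section Barrier

variable {R ι : Type*} [CommRing R] [Fintype ι]

/-- The polynomial `1 + 2 (1 + G²) ∏ (1 + fᵢ²) - (∏ fᵢ) t²` in `t`, the initial term `P₀` of the
elimination. -/
noncomputable def barrier (f : ι → R) (G : R) : Polynomial R :=
  1 + Polynomial.C (2 * (1 + G ^ 2) * ∏ i, (1 + f i ^ 2)) -
    Polynomial.C (∏ i, f i) * Polynomial.X ^ 2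

lemma eval₂_barrier {S : Type*} [CommRing S] (φ : R →+* S) (f : ι → R) (G : R) (t : S) :
    (barrier f G).eval₂ φ t =
      1 + 2 * (1 + φ G ^ 2) * ∏ i, (1 + φ (f i) ^ 2) - (∏ i, φ (f i)) * t ^ 2 := by
  simp [barrier, Polynomial.eval₂_mul, Polynomial.eval₂_pow, Polynomial.eval₂_finsetProd,
    map_ofNat φ 2]

lemma eval₂_barrier_lt_one_iff {K : Type*} [CommRing K] [LinearOrder K] [IsStrictOrderedRing K]
    {φ : R →+* K} {f : ι → R} {G : R} {t : K} :
    (barrier f G).eval₂ φ t < 1 ↔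
      2 * (1 + φ G ^ 2) * ∏ i, (1 + φ (f i) ^ 2) < (∏ i, φ (f i)) * t ^ 2 := by
  rw [eval₂_barrier]
  constructor <;> intro h <;> linarith

lemma eval₂_barrier_zero_nonneg {K : Type*} [CommRing K] [LinearOrder K] [IsStrictOrderedRing K]
    (φ : R →+* K) (f : ι → R) (G : R) : 0 ≤ (barrier f G).eval₂ φ 0 := by
  have hL : 0 ≤ 2 * (1 + φ G ^ 2) * ∏ i, (1 + φ (f i) ^ 2) :=
    mul_nonneg (by positivity) (Finset.prod_nonneg fun i _ => by positivity)
  rw [eval₂_barrier]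
  linarith

lemma exists_eval₂_barrier_le_neg_one {φ : R →+* ℝ} {f : ι → R} (hf : ∀ i, 0 < φ (f i)) (G : R) :
    ∃ t, 0 ≤ t ∧ (barrier f G).eval₂ φ t ≤ -1 := by
  set p := ∏ i, φ (f i)
  set L := 2 * (1 + φ G ^ 2) * ∏ i, (1 + φ (f i) ^ 2)
  have hp : 0 < p := Finset.prod_pos fun i _ => hf i
  have : 0 ≤ L := by positivity
  refine ⟨√((L + 2) / p), Real.sqrt_nonneg _, ?_⟩
  rw [eval₂_barrier, Real.sq_sqrt (by positivity), mul_div_cancel₀ _ hp.ne']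
  linarith

end Barrier

section Elimination

variable {R K : Type*} [CommRing R] [CommRing K] [LinearOrder K] [IsStrictOrderedRing K]

/-- The elimination step `1 + t² ((1 + f²) P² - f)`: where it is less than `1`, both `f > 0` and
`P < 1` hold. -/
noncomputable def eliminate (f : R) (P : Polynomial R) : Polynomial R :=
  1 + Polynomial.X ^ 2 * (Polynomial.C (1 + f ^ 2) * P ^ 2 - Polynomial.C f)

lemma eval₂_eliminate {S : Type*} [CommRing S] (φ : R →+* S) (f : R) (P : Polynomial R) (t : S) :
    (eliminate f P).eval₂ φ t = 1 + t ^ 2 * ((1 + φ f ^ 2) * P.eval₂ φ t ^ 2 - φ f) := by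
  simp [eliminate, Polynomial.eval₂_mul, Polynomial.eval₂_pow]

lemma pos_and_lt_one_of_eval₂_eliminate_lt_one {φ : R →+* K} {f : R} {P : Polynomial R} {t : K}
    (h : (eliminate f P).eval₂ φ t < 1) : 0 < φ f ∧ P.eval₂ φ t < 1 := by
  rw [eval₂_eliminate] at h
  have hlt : (1 + φ f ^ 2) * P.eval₂ φ t ^ 2 < φ f := by
    by_contra! hge
    linarith [mul_nonneg (sq_nonneg t) (sub_nonneg.2 hge)]
  refine ⟨lt_of_le_of_lt (by positivity) hlt, ?_⟩
  by_contra! hP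
  have hle : 1 + φ f ^ 2 ≤ (1 + φ f ^ 2) * P.eval₂ φ t ^ 2 :=
    le_mul_of_one_le_right (by positivity) (one_le_pow₀ hP)
  linarith [sq_nonneg (φ f - 1), sq_nonneg (φ f)]

lemma eval₂_eliminate_le_neg_one {φ : R →+* K} {f : R} {P : Polynomial R} {t : K}
    (hP : P.eval₂ φ t = 0) (hf : 2 ≤ φ f * t ^ 2) : (eliminate f P).eval₂ φ t ≤ -1 := by
  rw [eval₂_eliminate, hP]
  linarith

lemma pos_and_lt_one_of_eval₂_foldr_eliminate_lt_one {φ : R →+* K} {P : Polynomial R} {t : K}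
    {l : List R} (h : (l.foldr eliminate P).eval₂ φ t < 1) :
    (∀ f ∈ l, 0 < φ f) ∧ P.eval₂ φ t < 1 := by
  induction l with
  | nil => exact ⟨by simp, h⟩
  | cons f l ih =>
    obtain ⟨hf, hl⟩ := pos_and_lt_one_of_eval₂_eliminate_lt_one h
    exact ⟨List.forall_mem_cons.2 ⟨hf, (ih hl).1⟩, (ih hl).2⟩

lemma eval₂_foldr_eliminate_zero_nonneg {φ : R →+* K} {P : Polynomial R}
    (hP : 0 ≤ P.eval₂ φ 0) (l : List R) : 0 ≤ (l.foldr eliminate P).eval₂ φ 0 := by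
  cases l with
  | nil => exact hP
  | cons f l => simp [eval₂_eliminate]

lemma exists_eval₂_foldr_eliminate_le_neg_one {φ : R →+* ℝ} {P : Polynomial R} {l : List R}
    (hP₀ : 0 ≤ P.eval₂ φ 0) (hP : ∃ t, 0 ≤ t ∧ P.eval₂ φ t ≤ -1)
    (hl : ∀ f ∈ l, ∀ t, P.eval₂ φ t < 1 → 2 ≤ φ f * t ^ 2) :
    ∃ t, 0 ≤ t ∧ (l.foldr eliminate P).eval₂ φ t ≤ -1 := by
  induction l with
  | nil => exact hP
  | cons f l ih =>
    rw [List.forall_mem_cons] at hl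
    obtain ⟨T, hT, hPT⟩ := ih hl.2
    obtain ⟨t, ht, hroot⟩ := intermediate_value_Icc' hT
      ((l.foldr eliminate P).continuous_eval₂ φ).continuousOn
      ⟨by linarith, eval₂_foldr_eliminate_zero_nonneg hP₀ l⟩
    have hPt : P.eval₂ φ t < 1 :=
      (pos_and_lt_one_of_eval₂_foldr_eliminate_lt_one (hroot.trans_lt one_pos)).2
    exact ⟨t, ht.1, eval₂_eliminate_le_neg_one hroot (hl.1 t hPt)⟩

end Elimination

section VerticalLines

variable {d : ℕ}

@[simp] lemma pt_last (x : Fin d → ℝ) (t : ℝ) : pt x t (Fin.last d) = t := by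
  simp [pt]

@[simp] lemma pt_castSucc (x : Fin d → ℝ) (t : ℝ) (i : Fin d) : pt x t i.castSucc = x i := by
  simp [pt]

@[simp] lemma init_pt (x : Fin d → ℝ) (t : ℝ) : (Fin.init (pt x t) : Fin d → ℝ) = x := by
  simp [pt]

@[simp] lemma pt_init_last (y : Fin (d + 1) → ℝ) : pt (Fin.init y) (y (Fin.last d)) = y := by
  simp [pt]

lemma pt_add_smul_en (x : Fin d → ℝ) (t c : ℝ) : pt x t + c • en d = pt x (t + c) := by
  ext i
  cases i using Fin.lastCases with
  | last => simp [en]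
  | cast j => simp [en, (Fin.castSucc_lt_last j).ne]

lemma pt_inj {x x' : Fin d → ℝ} {t t' : ℝ} : pt x t = pt x' t' ↔ x = x' ∧ t = t' :=
  Fin.snoc_inj

lemma continuous_eval_pt (Q : MvPolynomial (Fin (d + 1)) ℝ) (x : Fin d → ℝ) :
    Continuous fun t : ℝ => eval (pt x t) Q :=
  Q.continuous_eval.comp (continuous_const.finSnoc continuous_id)

lemma pt_mem_setA {m : ℕ} {g : Fin (m + 1) → MvPolynomial (Fin d) ℝ} {x : Fin d → ℝ} :
    pt x 0 ∈ setA g ↔ ∀ i : Fin m, 0 < eval x (g i.castSucc) := by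
  simp [setA]

lemma mem_cyl_setA_of_forall_pos {m : ℕ} {g : Fin (m + 1) → MvPolynomial (Fin d) ℝ}
    {x : Fin (d + 1) → ℝ} (hx : ∀ i : Fin m, 0 < eval (Fin.init x) (g i.castSucc)) :
    x ∈ cyl (setA g) (en d) :=
  ⟨pt (Fin.init x) 0, pt_mem_setA.2 hx, x (Fin.last d), by simp [pt_add_smul_en]⟩

lemma pt_mem_setS {Q : MvPolynomial (Fin (d + 1)) ℝ} {x : Fin d → ℝ} {t : ℝ} :
    pt x t ∈ setS Q ↔ ∃ s, 0 < s ∧ s ≤ t ∧ eval (pt x s) Q ≤ 0 := by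
  constructor
  · rintro ⟨y, ⟨hy, hy₀⟩, c, hc, h⟩
    rw [← pt_init_last y, pt_add_smul_en, pt_inj] at h
    obtain ⟨rfl, rfl⟩ := h
    exact ⟨y (Fin.last d), hy₀, by linarith, by simpa using hy⟩
  · rintro ⟨s, hs, hst, hQ⟩
    exact ⟨pt x s, ⟨hQ, by simpa using hs⟩, t - s, sub_nonneg.2 hst, by simp [pt_add_smul_en]⟩

lemma piN_image_setS_eq_setA {m : ℕ} {g : Fin (m + 1) → MvPolynomial (Fin d) ℝ}
    {Q : MvPolynomial (Fin (d + 1)) ℝ}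
    (h : ∀ x, (∃ t, 0 < t ∧ eval (pt x t) Q ≤ 0) ↔ ∀ i : Fin m, 0 < eval x (g i.castSucc)) :
    piN '' setS Q = setA g := by
  ext a
  constructor
  · rintro ⟨y, hy, rfl⟩
    rw [← pt_init_last y, pt_mem_setS] at hy
    obtain ⟨s, hs, -, hQ⟩ := hy
    exact pt_mem_setA.2 ((h _).1 ⟨s, hs, hQ⟩)
  · rintro ⟨ha, ha₀⟩
    obtain ⟨t, ht, hQ⟩ := (h _).2 ha
    refine ⟨pt (Fin.init a) t, pt_mem_setS.2 ⟨t, ht, le_rfl, hQ⟩, ?_⟩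
    rw [piN, init_pt, ← ha₀, pt_init_last]

lemma exists_root_of_eval_nonpos {Q : MvPolynomial (Fin (d + 1)) ℝ} {x : Fin d → ℝ} {t : ℝ}
    (hQ₀ : 0 < eval (pt x 0) Q) (ht : 0 ≤ t) (hQt : eval (pt x t) Q ≤ 0) :
    ∃ r, 0 < r ∧ r ≤ t ∧ eval (pt x r) Q = 0 := by
  obtain ⟨r, hr, hroot⟩ :=
    intermediate_value_Ioc' ht (continuous_eval_pt Q x).continuousOn ⟨hQt, hQ₀⟩
  exact ⟨r, hr.1, hr.2, hroot⟩

end VerticalLines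

section SeparatingPolynomial

variable {d : ℕ}

/-- A univariate polynomial with coefficients in `ℝ[x']`, viewed in `ℝ[x', x_n]` by substituting
`x_n` for its variable. -/
noncomputable def ofUnivariate (P : Polynomial (MvPolynomial (Fin d) ℝ)) :
    MvPolynomial (Fin (d + 1)) ℝ :=
  P.eval₂ (rename Fin.castSucc : _ →ₐ[ℝ] _).toRingHom (X (Fin.last d))

lemma eval_pt_ofUnivariate (P : Polynomial (MvPolynomial (Fin d) ℝ)) (x : Fin d → ℝ) (t : ℝ) :
    eval (pt x t) (ofUnivariate P) = P.eval₂ (eval x) t := by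
  have hcomp : (eval (pt x t)).comp (rename Fin.castSucc : _ →ₐ[ℝ] _).toRingHom = eval x := by
    ext i <;> simp
  rw [ofUnivariate, Polynomial.hom_eval₂, hcomp, eval_X, pt_last]

variable {m : ℕ}

/-- The polynomial `Q` of the theorem: the barrier of `g₁, …, g_m` and `g_{m+1}` after eliminating
the inequalities `gᵢ > 0`, `i ≤ m`. -/
noncomputable def separatingPolynomial (g : Fin (m + 1) → MvPolynomial (Fin d) ℝ) :
    MvPolynomial (Fin (d + 1)) ℝ :=
  ofUnivariate <| (List.ofFn fun i : Fin m => g i.castSucc).foldr eliminate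
    (barrier (fun i : Fin m => g i.castSucc) (g (Fin.last m)))

variable {g : Fin (m + 1) → MvPolynomial (Fin d) ℝ} {x : Fin d → ℝ} {t : ℝ}

lemma pos_and_max_lt_abs_of_eval_separatingPolynomial_nonpos
    (h : eval (pt x t) (separatingPolynomial g) ≤ 0) :
    (∀ i : Fin m, 0 < eval x (g i.castSucc)) ∧
      max |eval x (g (Fin.last m))|
        (|eval x (g (Fin.last m))| / √(∏ i : Fin m, eval x (g i.castSucc))) < |t| := by
  rw [separatingPolynomial, eval_pt_ofUnivariate] at h
  obtain ⟨hg, hbarrier⟩ :=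
    pos_and_lt_one_of_eval₂_foldr_eliminate_lt_one (h.trans_lt one_pos)
  rw [List.forall_mem_ofFn_iff] at hg
  exact ⟨hg, max_abs_lt_abs_of_lt_prod_mul_sq hg (eval₂_barrier_lt_one_iff.1 hbarrier)⟩

lemma exists_eval_separatingPolynomial_le_neg_one
    (hg : ∀ i : Fin m, 0 < eval x (g i.castSucc)) :
    ∃ t, 0 ≤ t ∧ eval (pt x t) (separatingPolynomial g) ≤ -1 := by
  simp only [separatingPolynomial, eval_pt_ofUnivariate]
  refine exists_eval₂_foldr_eliminate_le_neg_one (eval₂_barrier_zero_nonneg _ _ _)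
    (exists_eval₂_barrier_le_neg_one hg _) (List.forall_mem_ofFn_iff.2 fun i t h => ?_)
  exact two_le_mul_sq_of_lt_prod_mul_sq hg (eval₂_barrier_lt_one_iff.1 h) i

lemma abs_eval_last_lt_of_eval_separatingPolynomial_nonpos
    (h : eval (pt x t) (separatingPolynomial g) ≤ 0) : |eval x (g (Fin.last m))| < |t| :=
  (le_max_left _ _).trans_lt (pos_and_max_lt_abs_of_eval_separatingPolynomial_nonpos h).2

lemma eval_separatingPolynomial_zero_pos (g : Fin (m + 1) → MvPolynomial (Fin d) ℝ)
    (x : Fin d → ℝ) : 0 < eval (pt x 0) (separatingPolynomial g) := by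
  by_contra! h
  have hlt := abs_eval_last_lt_of_eval_separatingPolynomial_nonpos h
  rw [abs_zero] at hlt
  exact hlt.not_ge (abs_nonneg _)

lemma setOf_eval_separatingPolynomial_nonpos_subset (g : Fin (m + 1) → MvPolynomial (Fin d) ℝ) :
    {x | eval x (separatingPolynomial g) ≤ 0} ⊆
      cyl (setA g) (en d) ∩
        {x | max (eval (Fin.init x) (g (Fin.last m)))
          (eval (Fin.init x) (g (Fin.last m)) /
            √(∏ i : Fin m, eval (Fin.init x) (g i.castSucc))) < |x (Fin.last d)|} := by
  intro x hx
  rw [Set.mem_ofPred_eq, ← pt_init_last x] at hx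
  obtain ⟨hg, hlt⟩ := pos_and_max_lt_abs_of_eval_separatingPolynomial_nonpos hx
  refine ⟨mem_cyl_setA_of_forall_pos hg, lt_of_le_of_lt ?_ hlt⟩
  gcongr <;> exact le_abs_self _

lemma exists_root_and_eval_separatingPolynomial_eq_neg_one
    (hg : ∀ i : Fin m, 0 < eval x (g i.castSucc)) :
    ∃ r, 0 < r ∧ eval x (g (Fin.last m)) ≤ r ∧ eval (pt x r) (separatingPolynomial g) = 0 ∧
      ∃ t, r ≤ t ∧ eval (pt x t) (separatingPolynomial g) = -1 := by
  obtain ⟨T, hT, hQT⟩ := exists_eval_separatingPolynomial_le_neg_one hg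
  obtain ⟨r, hr, hrT, hroot⟩ :=
    exists_root_of_eval_nonpos (eval_separatingPolynomial_zero_pos g x) hT (by linarith)
  have hGr := abs_eval_last_lt_of_eval_separatingPolynomial_nonpos hroot.le
  rw [abs_of_pos hr] at hGr
  obtain ⟨t, ht, hQt⟩ : -1 ∈ (fun t => eval (pt x t) (separatingPolynomial g)) '' Set.Icc r T :=
    intermediate_value_Icc' hrT (continuous_eval_pt _ x).continuousOn ⟨hQT, by linarith⟩
  exact ⟨r, hr, (le_abs_self _).trans hGr.le, hroot, t, ht.1, hQt⟩

end SeparatingPolynomial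

end Pecker

theorem lemma3p2_general {d m : ℕ} (g : Fin (m + 1) → MvPolynomial (Fin d) ℝ) :
    ∃ Q : MvPolynomial (Fin (d + 1)) ℝ,
      ({x : Fin (d + 1) → ℝ | MvPolynomial.eval x Q ≤ 0} ⊆
        Pecker.cyl (Pecker.setA g) (Pecker.en d) ∩
          {x : Fin (d + 1) → ℝ |
            max (MvPolynomial.eval (Fin.init x) (g (Fin.last m)))
              (MvPolynomial.eval (Fin.init x) (g (Fin.last m)) /
                Real.sqrt (∏ i : Fin m, MvPolynomial.eval (Fin.init x) (g i.castSucc)))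
              < |x (Fin.last d)|}) ∧
      (∀ x' : Fin d → ℝ, Pecker.pt x' 0 ∈ Pecker.setA g →
        ∃ r : ℝ, 0 < r ∧ MvPolynomial.eval x' (g (Fin.last m)) ≤ r ∧
          MvPolynomial.eval (Pecker.pt x' r) Q = 0 ∧
          ∃ t : ℝ, r ≤ t ∧ MvPolynomial.eval (Pecker.pt x' t) Q = -1) ∧
      Pecker.piN '' Pecker.setS Q = Pecker.setA g ∧
      (∀ (x' : Fin d → ℝ) (xn : ℝ), Pecker.pt x' xn ∈ Pecker.setS Q →
        ∃ rn tn : ℝ, 0 < rn ∧ 0 ≤ tn ∧ xn = rn + tn ∧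
          MvPolynomial.eval (Pecker.pt x' rn) Q = 0) := by
  refine ⟨Pecker.separatingPolynomial g, Pecker.setOf_eval_separatingPolynomial_nonpos_subset g,
    fun x' hx' => ?_, Pecker.piN_image_setS_eq_setA fun x' => ⟨?_, fun hg => ?_⟩,
    fun x' xn hS => ?_⟩
  · exact Pecker.exists_root_and_eval_separatingPolynomial_eq_neg_one (Pecker.pt_mem_setA.1 hx')
  · rintro ⟨t, -, hQ⟩
    exact (Pecker.pos_and_max_lt_abs_of_eval_separatingPolynomial_nonpos hQ).1
  · obtain ⟨r, hr, -, hroot, -⟩ :=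
      Pecker.exists_root_and_eval_separatingPolynomial_eq_neg_one hg
    exact ⟨r, hr, hroot.le⟩
  · obtain ⟨t, ht, htxn, hQ⟩ := Pecker.pt_mem_setS.1 hS
    obtain ⟨r, hr, hrt, hroot⟩ := Pecker.exists_root_of_eval_nonpos
      (Pecker.eval_separatingPolynomial_zero_pos g x') ht.le hQ
    exact ⟨r, xn - r, hr, by linarith, by ring, hroot⟩

theorem lemma3p2 {d m : ℕ} (g : Fin (m + 1) → MvPolynomial (Fin d) ℝ)
    (hg : Pecker.IsAdmissible g) :
    ∃ Q : MvPolynomial (Fin (d + 1)) ℝ,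
      ({x : Fin (d + 1) → ℝ | MvPolynomial.eval x Q ≤ 0} ⊆
        Pecker.cyl (Pecker.setA g) (Pecker.en d) ∩
          {x : Fin (d + 1) → ℝ |
            max (MvPolynomial.eval (Fin.init x) (g (Fin.last m)))
              (MvPolynomial.eval (Fin.init x) (g (Fin.last m)) /
                Real.sqrt (∏ i : Fin m, MvPolynomial.eval (Fin.init x) (g i.castSucc)))
              < |x (Fin.last d)|}) ∧
      (∀ x' : Fin d → ℝ, Pecker.pt x' 0 ∈ Pecker.setA g →
        ∃ r : ℝ, 0 < r ∧ MvPolynomial.eval x' (g (Fin.last m)) ≤ r ∧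
          MvPolynomial.eval (Pecker.pt x' r) Q = 0 ∧
          ∃ t : ℝ, r ≤ t ∧ MvPolynomial.eval (Pecker.pt x' t) Q = -1) ∧
      Pecker.piN '' Pecker.setS Q = Pecker.setA g ∧
      (∀ (x' : Fin d → ℝ) (xn : ℝ), Pecker.pt x' xn ∈ Pecker.setS Q →
        ∃ rn tn : ℝ, 0 < rn ∧ 0 ≤ tn ∧ xn = rn + tn ∧
          MvPolynomial.eval (Pecker.pt x' rn) Q = 0) :=
  lemma3p2_general g
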